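/- All $^*$-algebras are complex, associative and unital (unit $1$), and $A^*$ denotes the algebraic dual of a $^*$-algebra $A$. Write $A_H=\{a\in A: a=a^*\}$ and $A_H^{++}=\{\sum_{n=1}^N a_n^*a_n\}$ (finite sums, the algebraically positive elements). A linear functional $\omega\in A^*$ is *algebraically positive* if $\omega(a)\ge 0$ for all $a\in A_H^{++}$, and *Hermitian* if $\omega^*=\omega$, where $\omega^*(a):=\overline{\omega(a^*)}$. For $a,b,c\in A$ let $(b\cdot\omega\cdot c)(a):=\omega(cab)$ and $(b\triangleright\omega)(a):=\omega(b^*ab)$. A *quasi-ordered $^*$-algebra* is a $^*$-algebra $A$ with a reflexive transitive relation $\lesssim$ on $A_H$ such that $0\lesssim 1$ and, whenever $a\lesssim b$, also $a+c\lesssim b+c$ for all $c\in A_H$ and $d^*ad\lesssim d^*bd$ for all $d\in A$. Put $A_H^+=\{a\in A_H: 0\lesssim a\}$, and let $A_H^{*,+}$ be the set of Hermitian $\omega\in A^*$ with $\omega(a)\ge 0$ for all $a\in A_H^+$. An *abstract $O^*$-algebra* $(A,\Omega)$ is a quasi-ordered $^*$-algebra $A$ with a linear subspace $\Omega\subseteq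 A^*$ that is closed under $\omega\mapsto b\cdot\omega\cdot c$ ($b,c\in A$) and under $\omega\mapsto\omega^*$, such that, with $\Omega_H^+:=\Omega\cap A_H^{*,+}$, the space $\Omega$ is the linear span of $\Omega_H^+$ and $A_H^+=\{a\in A_H:\omega(a)\ge 0\text{ for all }\omega\in\Omega_H^+\}$. Let $\Omega_H$ be the set of Hermitian $\omega\in\Omega$; the *states* are the $\omega\in\Omega_H^+$ with $\omega(1)=1$. The *strong topology* on $A$ is the locally convex topology defined by the seminorms $a\mapsto\sqrt{\omega(a^*a)}$, $\omega\in\Omega_H^+$. - $(A,\Omega)$ is *downwards closed* if every $\rho\in A_H^{*,+}$ for which there is an $\omega\in\Omega_H^+$ with $\omega-\rho\in A_H^{*,+}$ belongs to $\Omega_H^+$. - A state $\omega$ is a *Stieltjes state* for $a\in A_H^+$ if for every $b\in A$ with $\omega(b^*b)=1$ one has $(b\triangleright\omega)(a)=0$ or $\sum_{n=1}^\infty \big((b\triangleright\omega)(a^n)\big)^{-1/(2n)}=\infty$. - An element $q\in A_H^+$ is *coercive* if $\varepsilon 1\lesssim q$ for some real $\varepsilon>0$. - $(A,\Omega)$ has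 *sufficiently many Stieltjes states* if there is a non-empty set $Q'\subseteq A_H^+$ of coercive, pairwise commuting elements such that every state is a Stieltjes state for every $q'\in Q'$, and such that, with $Q:=\{\lambda q_1'\cdots q_N' : \lambda\in[1,\infty),\ N\ge 1,\ q_1',\dots,q_N'\in Q'\}$ and $Q^{\downarrow}:=\{a\in A:\ \forall q\in Q\ \exists r,s\in Q:\ a^*q^2a\lesssim r^2\text{ and }aq^2a^*\lesssim s^2\}$, the set $Q^{\downarrow}\cap A_H^+$ is strongly dense in $A_H^+$. - $(A,\Omega)$ is *regular* if every algebraically positive $\omega\in\Omega_H$ belongs to $\Omega_H^+$. **Corollary.** Every downwards closed abstract $O^*$-algebra with sufficiently many Stieltjes states is regular: every algebraically positive Hermitian functional in $\Omega$ is positive. -/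

import Mathlib

open scoped ComplexOrder Topology

namespace OStar

section Basic

variable {A : Type*} [Ring A] [StarRing A]

/-- The Hermitian element `d* a d`, for Hermitian `a` and arbitrary `d`. -/
def conjBy (d : A) (a : selfAdjoint A) : selfAdjoint A :=
  ⟨star d * (a : A) * d, IsSelfAdjoint.conjugate' a.2 d⟩

/-- The algebraically positive elements: finite sums of elements of the form `a* a`. -/
def algPosElements (A : Type*) [Ring A] [StarRing A] : Set A :=
  {x | ∃ (N : ℕ) (f : Fin N → A), x = ∑ i, star (f i) * f i}

variable [Algebra ℂ A]

/-- A linear functional is algebraically positive if it is non-negative on all algebraically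
positive elements. In the order of `ℂ`, `0 ≤ z` means that `z` is real and non-negative. -/
def IsAlgPos (ω : Module.Dual ℂ A) : Prop :=
  ∀ x ∈ algPosElements A, 0 ≤ ω x

/-- The bimodule structure on the algebraic dual: `(b · ω · c)(x) = ω (c x b)`. -/
def bimod (b : A) (ω : Module.Dual ℂ A) (c : A) : Module.Dual ℂ A :=
  ω ∘ₗ LinearMap.mulLeft ℂ c ∘ₗ LinearMap.mulRight ℂ b

/-- The action `a ▷ ω = a · ω · a*`, that is, `(a ▷ ω)(x) = ω (a* x a)`. -/
def act (a : A) (ω : Module.Dual ℂ A) : Module.Dual ℂ A :=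
  bimod a ω (star a)

theorem act_apply (a : A) (ω : Module.Dual ℂ A) (x : A) :
    act a ω x = ω (star a * (x * a)) := rfl

variable [StarModule ℂ A]

/-- The antilinear involution on the algebraic dual: `ω*(a)` is the conjugate of `ω(a*)`. -/
def dualStar (ω : Module.Dual ℂ A) : Module.Dual ℂ A where
  toFun a := star (ω (star a))
  map_add' a b := by simp
  map_smul' c a := by simp

/-- The Hermitian linear functionals. -/
def IsHermFunctional (ω : Module.Dual ℂ A) : Prop := dualStar ω = ω

/-- The growth condition for a state `ω` (whose values on Hermitian elements are real) to be a
Stieltjes state for the positive element `a`: for all `b` with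
`ω(b* b) = 1`, either `(b ▷ ω)(a) = 0` or the series of the
`((b ▷ ω)(aⁿ))^(-1/(2n))`, `n ≥ 1`, diverges. The series is indexed by `n + 1` with `n : ℕ`
and taken in `[0, ∞]`. -/
def IsStieltjesState (ω : Module.Dual ℂ A) (a : selfAdjoint A) : Prop :=
  ∀ b : A, ω (star b * b) = 1 →
    act b ω (a : A) = 0 ∨
    ∑' n : ℕ, ENNReal.ofReal ((act b ω ((a : A) ^ (n + 1))).re) ^
      (-(1 / (2 * ((n : ℝ) + 1)))) = ⊤

end Basic

/-- A quasi-order on the Hermitian elements that turns the unital complex `*`-algebra `A` into a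
quasi-ordered `*`-algebra. -/
structure QuasiOrdered (A : Type*) [Ring A] [StarRing A] where
  /-- the quasi-order on the Hermitian elements -/
  le : selfAdjoint A → selfAdjoint A → Prop
  le_refl : ∀ a, le a a
  le_trans : ∀ a b c, le a b → le b c → le a c
  add_le_add : ∀ a b c, le a b → le (a + c) (b + c)
  conj_le_conj : ∀ a b (d : A), le a b → le (conjBy d a) (conjBy d b)
  zero_le_one : le 0 1

namespace QuasiOrdered

variable {A : Type*} [Ring A] [StarRing A]

/-- The convex cone of positive elements. -/
def posElements (P : QuasiOrdered A) : Set (selfAdjoint A) := {a | P.le 0 a}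

/-- The set `Q↓` of all `a` such that for every `q ∈ Q` there are `r, s ∈ Q` with
`a* q² a ≲ r²` and `a q² a* ≲ s²`. -/
def down (P : QuasiOrdered A) (Q : Set (selfAdjoint A)) : Set A :=
  {a | ∀ q ∈ Q, ∃ r ∈ Q, ∃ s ∈ Q,
    P.le (conjBy a (q ^ 2)) (r ^ 2) ∧ P.le (conjBy (star a) (q ^ 2)) (s ^ 2)}

/-- The positive elements of `Q↓`, with respect to the order inherited from `A`. -/
def downPos (P : QuasiOrdered A) (Q : Set (selfAdjoint A)) : Set A :=
  {a | ∃ h : selfAdjoint A, (h : A) = a ∧ h ∈ P.posElements ∧ a ∈ P.down Q}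

theorem star_mul_self_pos (P : QuasiOrdered A) (a : A) :
    (⟨star a * a, IsSelfAdjoint.star_mul_self a⟩ : selfAdjoint A) ∈ P.posElements := by
  have h := P.conj_le_conj 0 1 a P.zero_le_one
  have h0 : conjBy a 0 = (0 : selfAdjoint A) := by
    ext; simp [conjBy]
  have h1 : conjBy a 1 = (⟨star a * a, IsSelfAdjoint.star_mul_self a⟩ : selfAdjoint A) := by
    ext; simp [conjBy]
  rw [h0, h1] at h
  exact h

variable [Algebra ℂ A] [StarModule ℂ A]

/-- A positive element `q` is coercive if `ε 1 ≲ q` for some real `ε > 0`. -/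
def IsCoercive (P : QuasiOrdered A) (q : selfAdjoint A) : Prop :=
  q ∈ P.posElements ∧ ∃ ε : ℝ, 0 < ε ∧ P.le (ε • (1 : selfAdjoint A)) q

/-- The relation `ω ≤ ρ` (used for Hermitian functionals): `ω(a) ≤ ρ(a)` for all positive `a`. -/
def dualLE (P : QuasiOrdered A) (ω ρ : Module.Dual ℂ A) : Prop :=
  ∀ a ∈ P.posElements, ω (a : A) ≤ ρ (a : A)

/-- The convex cone of positive Hermitian functionals in the whole algebraic dual. -/
def dualPos (P : QuasiOrdered A) : Set (Module.Dual ℂ A) :=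
  {ω | IsHermFunctional ω ∧ P.dualLE 0 ω}

/-- The positive semidefinite form `⟨a, b⟩ = ω(a* b)` of a positive Hermitian functional. -/
@[reducible] noncomputable def preInner (P : QuasiOrdered A) {ω : Module.Dual ℂ A}
    (hω : ω ∈ P.dualPos) : PreInnerProductSpace.Core ℂ A where
  inner a b := ω (star a * b)
  conj_inner_symm a b := by
    have h : star (ω (star (star a * b))) = ω (star a * b) :=
      LinearMap.congr_fun hω.1 (star a * b)
    simpa using h
  re_inner_nonneg a := by
    have h := hω.2 _ (P.star_mul_self_pos a)
    exact (Complex.le_def.1 h).1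
  add_left a b c := by simp [add_mul]
  smul_left a b r := by simp

/-- The strong seminorm `a ↦ √(ω(a* a))` of a positive Hermitian functional `ω`. -/
noncomputable def strongSeminorm (P : QuasiOrdered A) {ω : Module.Dual ℂ A}
    (hω : ω ∈ P.dualPos) : Seminorm ℂ A :=
  letI : PreInnerProductSpace.Core ℂ A := P.preInner hω
  letI : SeminormedAddCommGroup A := InnerProductSpace.Core.toSeminormedAddCommGroup (𝕜 := ℂ)
  letI : NormedSpace ℂ A := InnerProductSpace.Core.toNormedSpace
  normSeminorm ℂ A

theorem strongSeminorm_apply (P : QuasiOrdered A) {ω : Module.Dual ℂ A}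
    (hω : ω ∈ P.dualPos) (a : A) :
    P.strongSeminorm hω a = √((ω (star a * a)).re) := rfl

end QuasiOrdered

/-- An abstract `O*`-algebra: a quasi-ordered `*`-algebra `A` together with a linear subspace and
sub-bimodule `Ω` of the algebraic dual of `A` that is stable under the involution, is spanned by
its positive functionals and determines the order of `A`. -/
structure AbstractOStarAlgebra (A : Type*) [Ring A] [StarRing A] [Algebra ℂ A] [StarModule ℂ A]
    extends QuasiOrdered A where
  /-- the space `Ω` of linear functionals -/
  Ω : Submodule ℂ (Module.Dual ℂ A)
  bimod_mem : ∀ ω ∈ Ω, ∀ b c : A, bimod b ω c ∈ Ω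
  dualStar_mem : ∀ ω ∈ Ω, dualStar ω ∈ Ω
  span_pos : Submodule.span ℂ ((Ω : Set (Module.Dual ℂ A)) ∩ toQuasiOrdered.dualPos) = Ω
  pos_eq : toQuasiOrdered.posElements =
    {a : selfAdjoint A | ∀ ω ∈ (Ω : Set (Module.Dual ℂ A)) ∩ toQuasiOrdered.dualPos, 0 ≤ ω (a : A)}

/-- The set of all `c q₁ ⋯ q_N` with `c ≥ 1` real, `N ≥ 1` and `q₁, …, q_N ∈ Q'`
(for pairwise commuting `Q'` all these products are Hermitian). -/
def dominantSet {A : Type*} [Ring A] [StarRing A] [Algebra ℂ A]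
    (Q' : Set (selfAdjoint A)) : Set (selfAdjoint A) :=
  {q | ∃ (c : ℝ) (l : List (selfAdjoint A)), 1 ≤ c ∧ l ≠ [] ∧ (∀ x ∈ l, x ∈ Q') ∧
    (q : A) = c • (l.map (fun x : selfAdjoint A => (x : A))).prod}

namespace AbstractOStarAlgebra

variable {A : Type*} [Ring A] [StarRing A] [Algebra ℂ A] [StarModule ℂ A]

/-- The Hermitian functionals in `Ω`. -/
def hermFunctionals (O : AbstractOStarAlgebra A) : Set (Module.Dual ℂ A) :=
  {ω | ω ∈ O.Ω ∧ IsHermFunctional ω}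

/-- The positive functionals in `Ω`. -/
def posFunctionals (O : AbstractOStarAlgebra A) : Set (Module.Dual ℂ A) :=
  (O.Ω : Set (Module.Dual ℂ A)) ∩ O.dualPos

/-- The states. -/
def states (O : AbstractOStarAlgebra A) : Set (Module.Dual ℂ A) :=
  {ω | ω ∈ O.posFunctionals ∧ ω 1 = 1}

/-- The abstract `O*`-algebra is regular if every algebraically positive Hermitian functional in
`Ω` is positive. -/
def IsRegular (O : AbstractOStarAlgebra A) : Prop :=
  ∀ ω ∈ O.hermFunctionals, IsAlgPos ω → ω ∈ O.posFunctionals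

/-- The abstract `O*`-algebra is downwards closed if every positive functional on `A` (in the whole
dual) that is dominated by some positive functional in `Ω` belongs to `Ω`. -/
def IsDownwardsClosed (O : AbstractOStarAlgebra A) : Prop :=
  ∀ ρ ∈ O.dualPos, (∃ ω ∈ O.posFunctionals, ω - ρ ∈ O.dualPos) → ρ ∈ O.posFunctionals

/-- The family of seminorms `a ↦ √(ω(a* a))`, indexed by the positive functionals in `Ω`. -/
noncomputable def strongSeminormFamily (O : AbstractOStarAlgebra A) :
    SeminormFamily ℂ A O.posFunctionals :=
  fun ω => O.strongSeminorm ω.2.2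

/-- The strong topology: the locally convex topology defined by the strong seminorms. -/
@[reducible] noncomputable def strongTopology (O : AbstractOStarAlgebra A) : TopologicalSpace A :=
  O.strongSeminormFamily.moduleFilterBasis.topology

/-- The abstract `O*`-algebra has sufficiently many Stieltjes states. -/
def HasSufficientlyManyStieltjesStates (O : AbstractOStarAlgebra A) : Prop :=
  ∃ Q' : Set (selfAdjoint A), Q'.Nonempty ∧
    (∀ q ∈ Q', O.IsCoercive q) ∧
    (∀ p ∈ Q', ∀ q ∈ Q', Commute (p : A) (q : A)) ∧
    (∀ ω ∈ O.states, ∀ q ∈ Q', IsStieltjesState ω q) ∧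
    ∀ a ∈ O.posElements, (a : A) ∈ closure[O.strongTopology] (O.downPos (dominantSet Q'))

end AbstractOStarAlgebra

end OStar

/-! Since `Ω` is spanned by positive functionals, an algebraically positive Hermitian `ω` in `Ω` is
dominated on squares by some positive `ρ` in `Ω`. The identity of the algebra therefore induces a
contraction `V` from the GNS completion of `ρ` to that of `ω`, and `T = V* V` weakly commutes with
left multiplication by Hermitian elements. If `√T` can be moved past a positive `a`, then `ω(a) =
⟨√T 1, a √T 1⟩ ≥ 0`. For `a` in `Q↓` this is possible: `a` is bounded relative to some `r` in `Q`,
so once `r` has dense range, `r⁻¹` and `a r⁻¹` extend to bounded operators that commute with `T`,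
hence with `√T` (`re_inner_map_nonneg_of_weakly_commuting`). Strong density of these `a` and strong
continuity of `ω` give the rest.

The Stieltjes condition enters through the dense range. Suppose `q ≥ ε` is symmetric and a unit
vector `ψ` has distance at least `δ > 0` from the range of `q`. The conjugate gradient method for `q
x = ψ` then never terminates, and its parameters `1 / ‖r‖²` and `1 / ⟨v, q v⟩` have sums at most `1
/ δ²` and `1 / ε`. The moments `⟨ψ, qⁿ ψ⟩` are bounded below by inverse products of these
parameters, so Carleman's inequality makes the Stieltjes series converge
(`carleman_series_ne_top_of_le_norm_sub`), a contradiction. No self-adjoint extension or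
representing measure is needed. -/

namespace OStar

/-! ### Carleman's inequality and Stieltjes parameters -/

theorem geom_mean_le_weighted_sum {a : ℕ → ℝ} (ha : ∀ n, 0 ≤ a n) (n : ℕ) :
    (∏ k ∈ Finset.range (n + 1), a k) ^ (1 / ((n : ℝ) + 1)) ≤
      Real.exp 1 * ((∑ k ∈ Finset.range (n + 1), ((k : ℝ) + 1) * a k) / ((n : ℝ) + 1) ^ 2) := by
  have hn : (0 : ℝ) < (n : ℝ) + 1 := by positivity
  -- The weights `k + 1` multiply the product by `(n + 1)!`, whose root is at least `(n + 1) / e`;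
  -- this produces the summable factor `1 / (n + 1)²`.
  have amgm := Real.geom_mean_le_arith_mean (Finset.range (n + 1)) (fun _ => (1 : ℝ))
    (fun k => ((k : ℝ) + 1) * a k) (fun _ _ => zero_le_one) (by simpa using hn)
    (fun k _ => mul_nonneg (by positivity) (ha k))
  simp only [Real.rpow_one, Finset.sum_const, Finset.card_range, nsmul_eq_mul, mul_one, one_mul,
    Finset.prod_mul_distrib] at amgm
  push_cast at amgm
  have hP : (0 : ℝ) ≤ ∏ k ∈ Finset.range (n + 1), a k := Finset.prod_nonneg fun k _ => ha k
  have hfac : (∏ k ∈ Finset.range (n + 1), ((k : ℝ) + 1)) = ((n + 1).factorial : ℝ) := by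
    rw [← Finset.prod_range_add_one_eq_factorial]; push_cast; rfl
  rw [hfac] at amgm
  have hF : (0 : ℝ) < ((n + 1).factorial : ℝ) := by positivity
  have hexp : ((n : ℝ) + 1) ≤
      Real.exp 1 * ((n + 1).factorial : ℝ) ^ (1 / ((n : ℝ) + 1)) := by
    have h := Real.pow_div_factorial_le_exp _ hn.le (n + 1)
    rw [div_le_iff₀ hF] at h
    have h2 := Real.rpow_le_rpow (by positivity) h (z := 1 / ((n : ℝ) + 1)) (by positivity)
    rw [Real.mul_rpow (Real.exp_pos _).le hF.le, ← Real.exp_mul, ← Real.rpow_natCast,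
      ← Real.rpow_mul hn.le] at h2
    push_cast at h2
    rwa [mul_one_div_cancel hn.ne', Real.rpow_one] at h2
  rw [Real.mul_rpow hF.le hP, ← one_div] at amgm
  set P := (∏ k ∈ Finset.range (n + 1), a k) ^ (1 / ((n : ℝ) + 1))
  have hP0 : 0 ≤ P := Real.rpow_nonneg hP _
  set F := ((n + 1).factorial : ℝ) ^ (1 / ((n : ℝ) + 1))
  set S := ∑ k ∈ Finset.range (n + 1), ((k : ℝ) + 1) * a k
  rw [le_div_iff₀ hn] at amgm
  rw [← mul_div_assoc, le_div_iff₀ (by positivity)]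
  have he := Real.exp_pos 1
  nlinarith [mul_le_mul_of_nonneg_left hexp (mul_nonneg hP0 hn.le),
    mul_le_mul_of_nonneg_left amgm he.le]

/-- Summation by parts with `1 / (n + 1)² ≤ 2 / (n + 1) - 2 / (n + 2)`. The subtracted boundary term
makes the induction close. -/
theorem sum_weighted_le {a : ℕ → ℝ} (ha : ∀ n, 0 ≤ a n) (N : ℕ) :
    ∑ n ∈ Finset.range N, (∑ k ∈ Finset.range (n + 1), ((k : ℝ) + 1) * a k) / ((n : ℝ) + 1) ^ 2 ≤
      2 * ∑ k ∈ Finset.range N, a k -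
        2 * (∑ k ∈ Finset.range N, ((k : ℝ) + 1) * a k) / ((N : ℝ) + 1) := by
  induction N with
  | zero => simp
  | succ N ih =>
    have hB : 0 ≤ ∑ k ∈ Finset.range (N + 1), ((k : ℝ) + 1) * a k :=
      Finset.sum_nonneg fun k _ => mul_nonneg (by positivity) (ha k)
    have hBs := Finset.sum_range_succ (fun k : ℕ => ((k : ℝ) + 1) * a k) N
    rw [Finset.sum_range_succ, Finset.sum_range_succ (fun k => a k)]
    set B := ∑ k ∈ Finset.range (N + 1), ((k : ℝ) + 1) * a k
    set B' := ∑ k ∈ Finset.range N, ((k : ℝ) + 1) * a k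
    have h1 : B' = B - ((N : ℝ) + 1) * a N := by linarith
    have h2 : 2 * B' / ((N : ℝ) + 1) = 2 * B / ((N : ℝ) + 1) - 2 * a N := by
      rw [h1]; field_simp
    have h3 : B / ((N : ℝ) + 1) ^ 2 ≤ 2 * B / ((N : ℝ) + 1) - 2 * B / ((N : ℝ) + 1 + 1) := by
      have : 2 * B / ((N : ℝ) + 1) - 2 * B / ((N : ℝ) + 1 + 1) - B / ((N : ℝ) + 1) ^ 2
          = B * N / (((N : ℝ) + 1) ^ 2 * ((N : ℝ) + 1 + 1)) := by
        field_simp; ring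
      have : 0 ≤ B * N / (((N : ℝ) + 1) ^ 2 * ((N : ℝ) + 1 + 1)) := by positivity
      linarith
    push_cast
    linarith

/-- A form of Carleman's inequality: the geometric means of a summable sequence of
non-negative numbers are summable. -/
theorem summable_geom_mean {a : ℕ → ℝ} (ha : ∀ n, 0 ≤ a n) (hs : Summable a) :
    Summable fun n : ℕ => (∏ k ∈ Finset.range (n + 1), a k) ^ (1 / ((n : ℝ) + 1)) := by
  refine Summable.of_nonneg_of_le
    (fun n => Real.rpow_nonneg (Finset.prod_nonneg fun k _ => ha k) _)
    (geom_mean_le_weighted_sum ha) (Summable.mul_left _ ?_)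
  have hnn : ∀ n : ℕ, 0 ≤ ∑ k ∈ Finset.range n, ((k : ℝ) + 1) * a k := fun n =>
    Finset.sum_nonneg fun k _ => mul_nonneg (by positivity) (ha k)
  refine summable_of_sum_range_le (c := 2 * ∑' n, a n)
    (fun n => div_nonneg (hnn _) (by positivity)) fun N => ?_
  have h1 := sum_weighted_le ha N
  have h2 := hs.sum_le_tsum (Finset.range N) fun k _ => ha k
  have h3 : 0 ≤ 2 * (∑ k ∈ Finset.range N, ((k : ℝ) + 1) * a k) / ((N : ℝ) + 1) :=
    div_nonneg (mul_nonneg zero_le_two (hnn N)) (by positivity)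
  linarith

/-- If moments `s` are bounded below by the products built from a summable sequence of
Stieltjes parameters `t`, then Carleman's condition for `s` fails. -/
theorem carleman_series_ne_top {t s f : ℕ → ℝ} (ht : ∀ n, 0 < t n) (hts : Summable t)
    (ht0 : t 0 = 1) (hf0 : f 0 ^ 2 = 1) (hf : ∀ n, (f (n + 1) * t (n + 1)) ^ 2 = f n ^ 2)
    (hs : ∀ n, t n * f n ^ 2 ≤ s n) :
    ∑' n : ℕ, ENNReal.ofReal (s (n + 1)) ^ (-(1 / (2 * ((n : ℝ) + 1)))) ≠ ⊤ := by
  set a : ℕ → ℝ := fun k => √(t k * t (k + 1)) with ha_def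
  have ha : ∀ n, 0 ≤ a n := fun n => Real.sqrt_nonneg _
  have hasq : ∀ n, a n ^ 2 = t n * t (n + 1) := fun n =>
    Real.sq_sqrt (mul_pos (ht _) (ht _)).le
  have has : Summable a := by
    refine Summable.of_nonneg_of_le ha (fun n => ?_) (hts.add ((summable_nat_add_iff 1).2 hts))
    refine Real.sqrt_le_iff.2 ⟨(add_pos (ht _) (ht _)).le, ?_⟩
    nlinarith [ht n, ht (n + 1), mul_pos (ht n) (ht (n + 1))]
  -- The recursion gives `f n ^ 2 = (t 1 ⋯ t n)⁻²`, and the squared product telescopes to the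
  -- reciprocal of `t n * f n ^ 2` because `t 0 = 1`.
  have hprod : ∀ n, (∏ k ∈ Finset.range n, a k) ^ 2 * (t n * f n ^ 2) = 1 := by
    intro n
    induction n with
    | zero => simp [ht0, hf0]
    | succ n ih =>
      rw [Finset.prod_range_succ, mul_pow, hasq, ← ih, ← hf n]; ring
  -- A vanishing moment would contribute a term `⊤`, the exponent being negative; strict positivity
  -- rules this out.
  have hf2 : ∀ n, 0 < f n ^ 2 := fun n => by
    have h := hprod n
    rcases (sq_nonneg (f n)).lt_or_eq with h0 | h0
    · exact h0
    · rw [← h0] at h; simp at h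
  have hspos : ∀ n, 0 < s n := fun n => (mul_pos (ht n) (hf2 n)).trans_le (hs n)
  have hbound : ∀ n : ℕ, ENNReal.ofReal (s (n + 1)) ^ (-(1 / (2 * ((n : ℝ) + 1)))) ≤
      ENNReal.ofReal ((∏ k ∈ Finset.range (n + 1), a k) ^ (1 / ((n : ℝ) + 1))) := by
    intro n
    rw [ENNReal.ofReal_rpow_of_pos (hspos _)]
    refine ENNReal.ofReal_le_ofReal ?_
    have hP : 0 ≤ ∏ k ∈ Finset.range (n + 1), a k := Finset.prod_nonneg fun k _ => ha k
    have h1 : (s (n + 1))⁻¹ ≤ (∏ k ∈ Finset.range (n + 1), a k) ^ 2 := by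
      rw [inv_le_iff_one_le_mul₀ (hspos _), ← hprod (n + 1)]
      exact mul_le_mul_of_nonneg_left (hs _) (sq_nonneg _)
    rw [Real.rpow_neg (hspos _).le, ← Real.inv_rpow (hspos _).le]
    refine (Real.rpow_le_rpow (inv_nonneg.2 (hspos _).le) h1 (by positivity)).trans_eq ?_
    rw [← Real.rpow_natCast, ← Real.rpow_mul hP]
    congr 1
    push_cast
    field_simp
  refine ne_top_of_le_ne_top ?_ (ENNReal.tsum_le_tsum hbound)
  exact (summable_geom_mean ha has).tsum_ofReal_ne_top

/-! ### The conjugate gradient method and failure of the Stieltjes condition -/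

section ConjugateGradient

variable {E : Type*} [SeminormedAddCommGroup E] [InnerProductSpace ℂ E]

/-- The residuals and (scaled) search directions of the conjugate gradient method for solving
`q x = ψ`. -/
noncomputable def conjGrad (q : E →ₗ[ℂ] E) (ψ : E) : ℕ → E × E
  | 0 => (ψ, 0)
  | n + 1 =>
    let r := (conjGrad q ψ n).1
    let v := (conjGrad q ψ n).2 + ((1 / ‖r‖ ^ 2 : ℝ) : ℂ) • r
    (r - ((1 / (inner ℂ v (q v)).re : ℝ) : ℂ) • q v, v)

/-- The residuals of the conjugate gradient method. -/
noncomputable def cgR (q : E →ₗ[ℂ] E) (ψ : E) (n : ℕ) : E := (conjGrad q ψ n).1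

/-- The scaled search directions of the conjugate gradient method, with a leading zero. -/
noncomputable def cgV (q : E →ₗ[ℂ] E) (ψ : E) (n : ℕ) : E := (conjGrad q ψ n).2

/-- The even Stieltjes parameters `1 / ‖r‖²`. -/
noncomputable def cgM (q : E →ₗ[ℂ] E) (ψ : E) (n : ℕ) : ℝ := 1 / ‖cgR q ψ n‖ ^ 2

/-- The odd Stieltjes parameters `1 / ⟨v, q v⟩`. -/
noncomputable def cgL (q : E →ₗ[ℂ] E) (ψ : E) (n : ℕ) : ℝ :=
  1 / (inner ℂ (cgV q ψ (n + 1)) (q (cgV q ψ (n + 1)))).re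

variable (q : E →ₗ[ℂ] E) (ψ : E)

theorem cgR_zero : cgR q ψ 0 = ψ := rfl

theorem cgV_zero : cgV q ψ 0 = 0 := rfl

theorem cgV_succ (n : ℕ) :
    cgV q ψ (n + 1) = cgV q ψ n + (cgM q ψ n : ℂ) • cgR q ψ n := rfl

theorem cgR_succ (n : ℕ) :
    cgR q ψ (n + 1) = cgR q ψ n - (cgL q ψ n : ℂ) • q (cgV q ψ (n + 1)) := rfl

theorem exists_cgR_eq (n : ℕ) : ∃ w, cgR q ψ n = ψ - q w := by
  induction n with
  | zero => exact ⟨0, by simp [cgR_zero]⟩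
  | succ n ih =>
    obtain ⟨w, hw⟩ := ih
    exact ⟨w + (cgL q ψ n : ℂ) • cgV q ψ (n + 1), by rw [cgR_succ, hw, map_add, map_smul]; abel⟩

/-- Modulo the range of `q` every residual is `ψ`, so the directions accumulate multiples of `ψ`.
Their norms are thus bounded below by the distance of `ψ` from that range. -/
theorem exists_cgV_eq (n : ℕ) :
    ∃ w, cgV q ψ n = ((∑ k ∈ Finset.range n, cgM q ψ k : ℝ) : ℂ) • ψ - q w := by
  induction n with
  | zero => exact ⟨0, by simp [cgV_zero]⟩
  | succ n ih =>
    obtain ⟨w, hw⟩ := ih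
    obtain ⟨w', hw'⟩ := exists_cgR_eq q ψ n
    refine ⟨w + (cgM q ψ n : ℂ) • w', ?_⟩
    rw [cgV_succ, hw, hw', map_add, map_smul, Finset.sum_range_succ, Complex.ofReal_add, add_smul,
      smul_sub]
    abel

variable {q ψ}

theorem le_norm_cgR {δ : ℝ} (hd : ∀ w, δ ≤ ‖ψ - q w‖) (n : ℕ) : δ ≤ ‖cgR q ψ n‖ := by
  obtain ⟨w, hw⟩ := exists_cgR_eq q ψ n
  exact hw ▸ hd w

theorem cgM_pos {δ : ℝ} (hδ : 0 < δ) (hd : ∀ w, δ ≤ ‖ψ - q w‖) (n : ℕ) : 0 < cgM q ψ n := by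
  have := hδ.trans_le (le_norm_cgR hd n)
  unfold cgM
  positivity

theorem cgM_mul_inner {δ : ℝ} (hδ : 0 < δ) (hd : ∀ w, δ ≤ ‖ψ - q w‖) (n : ℕ) :
    (cgM q ψ n : ℂ) * inner ℂ (cgR q ψ n) (cgR q ψ n) = 1 := by
  have := hδ.trans_le (le_norm_cgR hd n)
  rw [inner_self_eq_norm_sq_to_K, cgM]
  push_cast
  have h : ((‖cgR q ψ n‖ : ℝ) : ℂ) ≠ 0 := by exact_mod_cast this.ne'
  exact one_div_mul_cancel (pow_ne_zero 2 h)

theorem sum_cgM_mul_le_norm_cgV {δ : ℝ} (hδ : 0 < δ) (hd : ∀ w, δ ≤ ‖ψ - q w‖) (n : ℕ) :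
    (∑ k ∈ Finset.range n, cgM q ψ k) * δ ≤ ‖cgV q ψ n‖ := by
  obtain ⟨w, hw⟩ := exists_cgV_eq q ψ n
  set M := ∑ k ∈ Finset.range n, cgM q ψ k
  have hM : 0 ≤ M := Finset.sum_nonneg fun k _ => (cgM_pos hδ hd k).le
  rcases hM.lt_or_eq with h0 | h0
  · have hM' : (M : ℂ) ≠ 0 := by exact_mod_cast h0.ne'
    have : cgV q ψ n = (M : ℂ) • (ψ - q ((M : ℂ)⁻¹ • w)) := by
      rw [hw, map_smul, smul_sub, smul_inv_smul₀ hM']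
    rw [this, norm_smul, Complex.norm_real, Real.norm_of_nonneg hM]
    exact mul_le_mul_of_nonneg_left (hd _) hM
  · rw [← h0, zero_mul]
    exact norm_nonneg _

theorem inner_map_pos {δ ε : ℝ} (hδ : 0 < δ) (hε : 0 < ε) (hd : ∀ w, δ ≤ ‖ψ - q w‖)
    (hpos : ∀ x, ε * ‖x‖ ^ 2 ≤ (inner ℂ x (q x)).re) (n : ℕ) :
    0 < (inner ℂ (cgV q ψ (n + 1)) (q (cgV q ψ (n + 1)))).re := by
  have hM : 0 < ∑ k ∈ Finset.range (n + 1), cgM q ψ k :=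
    Finset.sum_pos (fun k _ => cgM_pos hδ hd k) (by simp)
  have hv := (mul_pos hM hδ).trans_le (sum_cgM_mul_le_norm_cgV hδ hd (n + 1))
  exact (by positivity : (0 : ℝ) < ε * ‖cgV q ψ (n + 1)‖ ^ 2).trans_le (hpos _)

theorem cgL_pos {δ ε : ℝ} (hδ : 0 < δ) (hε : 0 < ε) (hd : ∀ w, δ ≤ ‖ψ - q w‖)
    (hpos : ∀ x, ε * ‖x‖ ^ 2 ≤ (inner ℂ x (q x)).re) (n : ℕ) : 0 < cgL q ψ n :=
  one_div_pos.2 (inner_map_pos hδ hε hd hpos n)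

theorem inner_map_self_eq_re (hq : ∀ x y, inner ℂ (q x) y = inner ℂ x (q y)) (x : E) :
    inner ℂ x (q x) = ((inner ℂ x (q x)).re : ℂ) := by
  refine (Complex.conj_eq_iff_re.1 ?_).symm
  rw [inner_conj_symm, hq]

theorem cgL_mul_inner {δ ε : ℝ} (hδ : 0 < δ) (hε : 0 < ε) (hd : ∀ w, δ ≤ ‖ψ - q w‖)
    (hq : ∀ x y, inner ℂ (q x) y = inner ℂ x (q y))
    (hpos : ∀ x, ε * ‖x‖ ^ 2 ≤ (inner ℂ x (q x)).re) (n : ℕ) :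
    (cgL q ψ n : ℂ) * inner ℂ (cgV q ψ (n + 1)) (q (cgV q ψ (n + 1))) = 1 := by
  rw [inner_map_self_eq_re hq, cgL]
  have := inner_map_pos hδ hε hd hpos n
  exact_mod_cast one_div_mul_cancel this.ne'

theorem cgM_smul_cgR (n : ℕ) :
    (cgM q ψ n : ℂ) • cgR q ψ n = cgV q ψ (n + 1) - cgV q ψ n := by
  rw [cgV_succ]; abel

theorem cgL_smul_map_cgV (n : ℕ) :
    (cgL q ψ n : ℂ) • q (cgV q ψ (n + 1)) = cgR q ψ n - cgR q ψ (n + 1) := by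
  rw [cgR_succ]; abel

/-- This single table contains all orthogonality relations of the method: differences in `n` give
those between residuals, differences in `k` the `q`-orthogonality of the directions. Both indices
are bounded by `N` because extending either one uses the other. -/
theorem inner_cgR_cgV_of_le (hq : ∀ x y, inner ℂ (q x) y = inner ℂ x (q y))
    (hm0 : ∀ n, cgM q ψ n ≠ 0) (hl0 : ∀ n, cgL q ψ n ≠ 0)
    (hm : ∀ n, (cgM q ψ n : ℂ) * inner ℂ (cgR q ψ n) (cgR q ψ n) = 1)
    (hl : ∀ n, (cgL q ψ n : ℂ) * inner ℂ (cgV q ψ (n + 1)) (q (cgV q ψ (n + 1))) = 1) (N : ℕ) :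
    ∀ k ≤ N, ∀ n ≤ N, inner ℂ (cgR q ψ k) (cgV q ψ n) = if k < n then (1 : ℂ) else 0 := by
  induction N with
  | zero =>
    intro k hk n hn
    obtain rfl : n = 0 := by lia
    simp [cgV_zero]
  | succ N ih =>
    have hV : ∀ k ≤ N, inner ℂ (cgR q ψ k) (cgV q ψ (N + 1)) = (1 : ℂ) := by
      intro k hk
      rw [cgV_succ, inner_add_right, inner_smul_right, ih k hk N le_rfl]
      rcases hk.lt_or_eq with h | rfl
      · have h0 : inner ℂ (cgR q ψ k) (cgR q ψ N) = 0 := by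
          have h1 : inner ℂ ((cgM q ψ k : ℂ) • cgR q ψ k) (cgR q ψ N) = 0 := by
            rw [← inner_conj_symm, cgM_smul_cgR, inner_sub_right, ih N le_rfl _ h,
              ih N le_rfl _ hk, if_neg (by lia), if_neg (by lia)]
            simp
          rw [inner_smul_left] at h1
          simpa [hm0 k] using h1
        simp [h, h0]
      · rw [hm]; simp
    have hR : ∀ n ≤ N + 1, inner ℂ (cgR q ψ (N + 1)) (cgV q ψ n) = (0 : ℂ) := by
      intro n hn
      rw [cgR_succ, inner_sub_left, inner_smul_left, Complex.conj_ofReal, hq]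
      rcases hn.lt_or_eq with h | rfl
      · rw [ih N le_rfl n (by lia), if_neg (by lia)]
        rcases n with _ | j
        · simp [cgV_zero]
        · have h1 : inner ℂ (cgV q ψ (N + 1)) ((cgL q ψ j : ℂ) • q (cgV q ψ (j + 1))) = 0 := by
            rw [← inner_conj_symm, cgL_smul_map_cgV, inner_sub_left, hV j (by lia),
              hV (j + 1) (by lia)]
            simp
          rw [inner_smul_right] at h1
          have h2 : inner ℂ (cgV q ψ (N + 1)) (q (cgV q ψ (j + 1))) = 0 := by
            simpa [hl0 j] using h1
          rw [h2]; simp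
      · rw [hV N le_rfl, hl, sub_self]
    intro k hk n hn
    rcases hk.lt_or_eq with h | rfl
    · rcases hn.lt_or_eq with h' | rfl
      · exact ih k (by lia) n (by lia)
      · rw [hV k (by lia), if_pos h]
    · rw [hR n hn, if_neg (by lia)]

/-- The Cauchy-Schwarz inequality for the form `⟨x, q y⟩`. -/
theorem norm_inner_map_sq_le (hq : ∀ x y, inner ℂ (q x) y = inner ℂ x (q y))
    (hpos : ∀ x, 0 ≤ (inner ℂ x (q x)).re) (x y : E) :
    ‖inner ℂ x (q y)‖ ^ 2 ≤ (inner ℂ x (q x)).re * (inner ℂ y (q y)).re := by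
  let c : PreInnerProductSpace.Core ℂ E :=
    { inner := fun x y => inner ℂ x (q y)
      conj_inner_symm := fun x y => by rw [inner_conj_symm, hq]
      re_inner_nonneg := hpos
      add_left := fun x y z => inner_add_left _ _ _
      smul_left := fun x y r => inner_smul_left _ _ _ }
  have h := @InnerProductSpace.Core.inner_mul_inner_self_le ℂ E _ _ _ c x y
  have h1 : ‖inner ℂ y (q x)‖ = ‖inner ℂ x (q y)‖ := by
    rw [← hq, ← inner_conj_symm, RCLike.norm_conj]
  calc ‖inner ℂ x (q y)‖ ^ 2 = ‖inner ℂ x (q y)‖ * ‖inner ℂ y (q x)‖ := by rw [h1, sq]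
    _ ≤ _ := h

/-- The sequence `x 0, y 0, x 1, y 1, …`. -/
def interleave (x y : ℕ → ℝ) (n : ℕ) : ℝ := if n % 2 = 0 then x (n / 2) else y (n / 2)

theorem interleave_even (x y : ℕ → ℝ) (n : ℕ) : interleave x y (2 * n) = x n := by
  simp [interleave]

theorem interleave_odd (x y : ℕ → ℝ) (n : ℕ) : interleave x y (2 * n + 1) = y n := by
  have : (2 * n + 1) / 2 = n := by lia
  simp [interleave, this, Nat.add_mod]

/-- If all conjugate gradient residuals are non-degenerate then Carleman's condition fails. -/
theorem carleman_series_ne_top_of_le_norm_sub (hψ : ‖ψ‖ = 1) {δ ε : ℝ} (hδ : 0 < δ) (hε : 0 < ε)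
    (hd : ∀ w, δ ≤ ‖ψ - q w‖) (hq : ∀ x y, inner ℂ (q x) y = inner ℂ x (q y))
    (hpos : ∀ x, ε * ‖x‖ ^ 2 ≤ (inner ℂ x (q x)).re) :
    ∑' n : ℕ, ENNReal.ofReal ((inner ℂ ψ ((q ^ (n + 1)) ψ)).re) ^
      (-(1 / (2 * ((n : ℝ) + 1)))) ≠ ⊤ := by
  have hMp := cgM_pos hδ hd
  have hLp := cgL_pos hδ hε hd hpos
  have hm := cgM_mul_inner hδ hd
  have hl := cgL_mul_inner hδ hε hd hq hpos
  have hpos0 : ∀ x, 0 ≤ (inner ℂ x (q x)).re := fun x =>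
    (mul_nonneg hε.le (sq_nonneg _)).trans (hpos x)
  have hRV : ∀ k n, inner ℂ (cgR q ψ k) (cgV q ψ n) = if k < n then (1 : ℂ) else 0 := fun k n =>
    inner_cgR_cgV_of_le hq (fun n => (hMp n).ne') (fun n => (hLp n).ne') hm hl (max k n) k
      (le_max_left _ _) n (le_max_right _ _)
  have hVV : ∀ n k, k ≤ n →
      inner ℂ (cgV q ψ k) (cgV q ψ n) = ((∑ j ∈ Finset.range k, cgM q ψ j : ℝ) : ℂ) := by
    intro n k
    induction k with
    | zero => simp [cgV_zero]
    | succ k ih =>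
      intro hk
      rw [cgV_succ, inner_add_left, inner_smul_left, ih (by lia), hRV, if_pos (by lia),
        Finset.sum_range_succ]
      simp
  have hVq : ∀ n k, n ≠ k → inner ℂ (q (cgV q ψ (n + 1))) (cgV q ψ (k + 1)) = 0 := by
    intro n k hnk
    have h : inner ℂ ((cgL q ψ n : ℂ) • q (cgV q ψ (n + 1))) (cgV q ψ (k + 1)) = 0 := by
      rw [cgL_smul_map_cgV, inner_sub_left, hRV, hRV]
      have : n < k + 1 ↔ n + 1 < k + 1 := by lia
      simp [this]
    rw [inner_smul_left] at h
    simpa [(hLp n).ne'] using h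
  -- With partial sum `M`, `‖v‖² = M` and `‖v‖ ≥ M δ` force `M ≤ 1 / δ²`.
  have hMsum : Summable (cgM q ψ) := by
    refine summable_of_sum_range_le (c := 1 / δ ^ 2) (fun n => (hMp n).le) fun n => ?_
    have h1 := sum_cgM_mul_le_norm_cgV hδ hd n
    have h2 : ‖cgV q ψ n‖ ^ 2 = ∑ j ∈ Finset.range n, cgM q ψ j := by
      have := hVV n n le_rfl
      rw [inner_self_eq_norm_sq_to_K] at this
      refine Complex.ofReal_injective ?_
      rw [← this, Complex.ofReal_pow]
      rfl
    set M := ∑ j ∈ Finset.range n, cgM q ψ j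
    have hM : 0 ≤ M := Finset.sum_nonneg fun k _ => (hMp k).le
    have h3 : (M * δ) ^ 2 ≤ M := h2 ▸ pow_le_pow_left₀ (by positivity) h1 2
    rw [le_div_iff₀ (by positivity)]
    rcases hM.lt_or_eq with h0 | h0
    · nlinarith
    · rw [← h0]; simp
  -- The residual `ψ - q w` is orthogonal to `w`, so `⟨w, q w⟩ = ⟨ψ, w⟩ = L ≤ ‖w‖`, and coercivity
  -- gives `ε L² ≤ L`.
  have hLsum : Summable (cgL q ψ) := by
    refine summable_of_sum_range_le (c := 1 / ε) (fun n => (hLp n).le) fun N => ?_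
    set w := ∑ n ∈ Finset.range N, (cgL q ψ n : ℂ) • cgV q ψ (n + 1) with hw
    set L := ∑ n ∈ Finset.range N, cgL q ψ n with hL
    have hR : cgR q ψ N = ψ - q w := by
      rw [hw, map_sum]
      simp only [map_smul, cgL_smul_map_cgV]
      rw [Finset.sum_range_sub', cgR_zero]
      abel
    have h1 : inner ℂ ψ w = (L : ℂ) := by
      rw [hw, inner_sum, hL]
      push_cast
      refine Finset.sum_congr rfl fun n _ => ?_
      have := hRV 0 (n + 1)
      rw [cgR_zero, if_pos (by lia)] at this
      rw [inner_smul_right, this, mul_one]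
    have h2 : inner ℂ (cgR q ψ N) w = 0 := by
      rw [hw, inner_sum]
      refine Finset.sum_eq_zero fun n hn => ?_
      rw [inner_smul_right, hRV, if_neg (by simp at hn; lia), mul_zero]
    have h3 : (inner ℂ w (q w)).re = L := by
      rw [hR, inner_sub_left, h1, hq, sub_eq_zero] at h2
      rw [← h2, Complex.ofReal_re]
    have h4 := hpos w
    rw [h3] at h4
    have h5 : L ≤ ‖w‖ := by
      have := norm_inner_le_norm (𝕜 := ℂ) ψ w
      rw [h1, hψ, one_mul, Complex.norm_real] at this
      exact (le_abs_self L).trans this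
    have hL0 : 0 ≤ L := Finset.sum_nonneg fun k _ => (hLp k).le
    rw [le_div_iff₀ hε]
    rcases hL0.lt_or_eq with h0 | h0
    · have : L ^ 2 ≤ ‖w‖ ^ 2 := pow_le_pow_left₀ hL0 h5 2
      have : L * (L * ε) ≤ L * 1 := by nlinarith
      exact le_of_mul_le_mul_left this h0
    · rw [← h0]; simp
  -- Krylov spaces: `V (n + 1)` contains `(q ^ n) ψ` and is orthogonal to the residual `n + 1` and
  -- to `q` of the direction `n + 2`.
  let V : ℕ → Submodule ℂ E := fun n =>
    Submodule.span ℂ ((fun i => cgV q ψ (i + 1)) '' Set.Iio n)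
  have hVmem : ∀ {i n}, i ≤ n → cgV q ψ i ∈ V n := by
    intro i n hi
    rcases i with _ | i
    · rw [cgV_zero]; exact zero_mem _
    · exact Submodule.subset_span ⟨i, hi, rfl⟩
  have hRmem : ∀ {i n}, i < n → cgR q ψ i ∈ V n := by
    intro i n hi
    have h : (cgM q ψ i : ℂ) • cgR q ψ i ∈ V n := by
      rw [cgM_smul_cgR]; exact sub_mem (hVmem hi) (hVmem hi.le)
    exact (Submodule.smul_mem_iff _ (by exact_mod_cast (hMp i).ne')).1 h
  have hqV : ∀ {n x}, x ∈ V n → q x ∈ V (n + 1) := by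
    intro n x hx
    have : V n ≤ (V (n + 1)).comap q := by
      refine Submodule.span_le.2 ?_
      rintro _ ⟨i, hi, rfl⟩
      have h : (cgL q ψ i : ℂ) • q (cgV q ψ (i + 1)) ∈ V (n + 1) := by
        have hi' : i < n := hi
        rw [cgL_smul_map_cgV]; exact sub_mem (hRmem (by lia)) (hRmem (by lia))
      have h0 : (cgL q ψ i : ℂ) ≠ 0 := by exact_mod_cast (hLp i).ne'
      exact (Submodule.smul_mem_iff (V (n + 1)) h0).1 h
    exact this hx
  have hpow : ∀ n, (q ^ n) ψ ∈ V (n + 1) := by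
    intro n
    induction n with
    | zero => simpa [cgR_zero] using hRmem (i := 0) (n := 1) one_pos
    | succ n ih => rw [pow_succ', Module.End.mul_apply]; exact hqV ih
  have horth : ∀ {n : ℕ} {z : E}, (∀ i < n, inner ℂ z (cgV q ψ (i + 1)) = 0) →
      ∀ x ∈ V n, inner ℂ z x = 0 := by
    intro n z hz x hx
    have : V n ≤ LinearMap.ker (innerₛₗ ℂ z) := by
      refine Submodule.span_le.2 ?_
      rintro _ ⟨i, hi, rfl⟩
      exact hz i hi
    exact this hx
  have hRorth : ∀ n, inner ℂ (cgR q ψ (n + 1)) ((q ^ n) ψ) = 0 := fun n =>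
    horth (fun i hi => by rw [hRV, if_neg (by lia)]) _ (hpow n)
  have hVorth : ∀ n, inner ℂ (q (cgV q ψ (n + 2))) ((q ^ n) ψ) = 0 := fun n =>
    horth (fun i hi => hVq (n + 1) i (by lia)) _ (hpow n)
  set c : ℕ → ℝ := fun n => ‖inner ℂ (cgR q ψ n) ((q ^ n) ψ)‖ with hc
  set e : ℕ → ℝ := fun n => ‖inner ℂ (q (cgV q ψ (n + 1))) ((q ^ n) ψ)‖ with he
  -- Pairing the two recursions with `(q ^ n) ψ` kills the newest term, which leaves the one-step
  -- relations for the interleaved sequences.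
  have hce : ∀ n, e n * cgL q ψ n = c n := by
    intro n
    have h := hRorth n
    rw [cgR_succ, inner_sub_left, inner_smul_left, Complex.conj_ofReal, sub_eq_zero] at h
    rw [hc, he]
    simp only
    rw [h, norm_mul, Complex.norm_real, Real.norm_of_nonneg (hLp n).le, mul_comm]
  have hec : ∀ n, c (n + 1) * cgM q ψ (n + 1) = e n := by
    intro n
    have h := hVorth n
    rw [cgV_succ, map_add, map_smul, inner_add_left, inner_smul_left, Complex.conj_ofReal,
      hq (cgR q ψ (n + 1)), ← Module.End.mul_apply, ← pow_succ', add_eq_zero_iff_eq_neg] at h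
    rw [hc, he]
    simp only
    rw [h, norm_neg, norm_mul, Complex.norm_real, Real.norm_of_nonneg (hMp _).le, mul_comm]
  have hqn : ∀ n x y, inner ℂ ((q ^ n) x) y = inner ℂ x ((q ^ n) y) := by
    intro n
    induction n with
    | zero => simp
    | succ n ih =>
      intro x y
      rw [pow_succ, Module.End.mul_apply, ih, hq, ← Module.End.mul_apply, ← pow_succ', pow_succ]
  refine carleman_series_ne_top (t := interleave (cgM q ψ) (cgL q ψ)) (f := interleave c e)
    (s := fun n => (inner ℂ ψ ((q ^ n) ψ)).re) ?_ ?_ ?_ ?_ ?_ ?_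
  · intro n
    obtain ⟨k, rfl | rfl⟩ := Nat.even_or_odd' n
    · rw [interleave_even]; exact hMp k
    · rw [interleave_odd]; exact hLp k
  · refine (HasSum.even_add_odd (m := ∑' n, cgM q ψ n) (m' := ∑' n, cgL q ψ n) ?_ ?_).summable
    · simp only [interleave_even]; exact hMsum.hasSum
    · simp only [interleave_odd]; exact hLsum.hasSum
  · have := interleave_even (cgM q ψ) (cgL q ψ) 0
    rw [mul_zero] at this
    rw [this, cgM, cgR_zero, hψ]; norm_num
  · have := interleave_even c e 0
    rw [mul_zero] at this
    rw [this, hc]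
    simp [cgR_zero, hψ]
  · intro n
    obtain ⟨k, rfl | rfl⟩ := Nat.even_or_odd' n
    · rw [interleave_even, interleave_odd, interleave_odd, hce]
    · have : 2 * k + 1 + 1 = 2 * (k + 1) := by ring
      rw [this, interleave_even, interleave_odd, interleave_even, hec]
  -- Cauchy-Schwarz for `(q ^ k) ψ`: against the residual for even moments, and against the
  -- direction in the form `⟨x, q y⟩` for odd ones.
  · intro n
    obtain ⟨k, rfl | rfl⟩ := Nat.even_or_odd' n
    · rw [interleave_even, interleave_even]
      have h1 : c k ≤ ‖cgR q ψ k‖ * ‖(q ^ k) ψ‖ := norm_inner_le_norm _ _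
      have h2 : (inner ℂ ψ ((q ^ (2 * k)) ψ)).re = ‖(q ^ k) ψ‖ ^ 2 := by
        rw [two_mul, pow_add, Module.End.mul_apply, ← hqn, inner_self_eq_norm_sq_to_K]
        norm_cast
      rw [h2]
      have h3 : 0 < ‖cgR q ψ k‖ := hδ.trans_le (le_norm_cgR hd k)
      rw [cgM, one_div_mul_eq_div, div_le_iff₀ (by positivity), ← mul_pow, mul_comm]
      exact pow_le_pow_left₀ (norm_nonneg _) h1 2
    · rw [interleave_odd, interleave_odd]
      have h1 := norm_inner_map_sq_le hq hpos0 (cgV q ψ (k + 1)) ((q ^ k) ψ)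
      rw [← hq] at h1
      have h2 : (inner ℂ ((q ^ k) ψ) (q ((q ^ k) ψ))).re = (inner ℂ ψ ((q ^ (2 * k + 1)) ψ)).re := by
        rw [hqn, ← Module.End.mul_apply, ← Module.End.mul_apply]
        have h : q ^ k * q * q ^ k = q ^ (2 * k + 1) := by
          rw [← pow_succ, ← pow_add]
          congr 1; ring
        rw [← h]
      rw [h2] at h1
      have h3 := inner_map_pos hδ hε hd hpos k
      rw [cgL, one_div_mul_eq_div, div_le_iff₀ h3, mul_comm]
      exact h1

end ConjugateGradient

/-! ### Transfer of positivity along a weakly commuting contraction -/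

/-- The bounded operators `B = r⁻¹` and `X = a r⁻¹` replace `r` and `a`. Both commute with `T = V*
V`, hence with `S = √T`, and `⟨V x, V (a x)⟩ = ⟨S x, S (a x)⟩` is a value of the non-negative form
`⟨B u, X u⟩`. -/
theorem re_inner_map_nonneg_of_weakly_commuting {D H K : Type*} [AddCommGroup D] [Module ℂ D]
    [NormedAddCommGroup H] [InnerProductSpace ℂ H] [CompleteSpace H]
    [NormedAddCommGroup K] [InnerProductSpace ℂ K] [CompleteSpace K]
    (j : D →ₗ[ℂ] H) (a r : D →ₗ[ℂ] D) (V : H →L[ℂ] K) (C : ℝ)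
    (hr : ∀ x y, inner ℂ (j (r x)) (j y) = inner ℂ (j x) (j (r y)))
    (ha : ∀ x y, inner ℂ (j (a x)) (j y) = inner ℂ (j x) (j (a y)))
    (hdense : DenseRange (j ∘ₗ r)) (hjr : ∀ x, ‖j x‖ ≤ C * ‖j (r x)‖)
    (har : ∀ x, ‖j (a x)‖ ≤ C * ‖j (r x)‖) (hpos : ∀ x, 0 ≤ (inner ℂ (j x) (j (a x))).re)
    (hVr : ∀ x y, inner ℂ (V (j (r x))) (V (j y)) = inner ℂ (V (j x)) (V (j (r y))))
    (hVa : ∀ x y, inner ℂ (V (j (a x))) (V (j y)) = inner ℂ (V (j x)) (V (j (a y)))) (x : D) :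
    0 ≤ (inner ℂ (V (j x)) (V (j (a x)))).re := by
  let T : H →L[ℂ] H := V.adjoint ∘L V
  have hT : ∀ u v, inner ℂ u (T v) = inner ℂ (V u) (V v) := fun u v => by
    simp [T, ContinuousLinearMap.adjoint_inner_right]
  have hTpos : 0 ≤ T := by
    rw [ContinuousLinearMap.nonneg_iff_isPositive]
    exact ContinuousLinearMap.isPositive_adjoint_comp_self V
  let B : H →L[ℂ] H := j.extendOfNorm (j ∘ₗ r)
  let X : H →L[ℂ] H := (j ∘ₗ a).extendOfNorm (j ∘ₗ r)
  have hB : ∀ x, B (j (r x)) = j x := LinearMap.extendOfNorm_eq hdense ⟨C, hjr⟩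
  have hX : ∀ x, X (j (r x)) = j (a x) := LinearMap.extendOfNorm_eq hdense ⟨C, har⟩
  have hBsymm : ∀ u v, inner ℂ (B u) v = inner ℂ u (B v) := by
    refine fun u v => hdense.induction_on₂ (p := fun u v => inner ℂ (B u) v = inner ℂ u (B v))
      (isClosed_eq (by fun_prop) (by fun_prop)) (fun x y => ?_) u v
    simp only [LinearMap.comp_apply, hB]
    exact (hr x y).symm
  have hTB : Commute T B := by
    refine ContinuousLinearMap.ext fun v => ext_inner_left ℂ fun u => ?_
    refine hdense.induction_on₂ (p := fun u v => inner ℂ u (T (B v)) = inner ℂ u (B (T v)))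
      (isClosed_eq (by fun_prop) (by fun_prop)) (fun x y => ?_) u v
    simp only [LinearMap.comp_apply]
    rw [← hBsymm, hB, hB, hT, hT, hVr]
  have hj : DenseRange j := hdense.mono (by rintro _ ⟨x, rfl⟩; exact ⟨r x, rfl⟩)
  -- `X` need not be symmetric; moving `a` to the left leaves only `B` on the right, where
  -- commutation with `T` is known.
  have hXB : ∀ y u, inner ℂ (j y) (X u) = inner ℂ (j (a y)) (B u) := by
    refine fun y u => hdense.induction_on
      (p := fun u => inner ℂ (j y) (X u) = inner ℂ (j (a y)) (B u)) u
      (isClosed_eq (by fun_prop) (by fun_prop)) (fun x => ?_)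
    simp only [LinearMap.comp_apply, hB, hX]
    exact (ha y x).symm
  have hTX : Commute T X := by
    refine ContinuousLinearMap.ext fun v => ext_inner_left ℂ fun u => ?_
    refine hdense.induction_on (p := fun v => inner ℂ u (T (X v)) = inner ℂ u (X (T v))) v
      (isClosed_eq (by fun_prop) (by fun_prop)) (fun x => ?_)
    refine hj.induction_on (p := fun u => inner ℂ u (T (X ((j ∘ₗ r) x))) =
      inner ℂ u (X (T ((j ∘ₗ r) x)))) u (isClosed_eq (by fun_prop) (by fun_prop)) (fun y => ?_)
    have h1 : B (T (j (r x))) = T (j x) := by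
      rw [← hB x]; exact (DFunLike.congr_fun hTB _).symm
    simp only [LinearMap.comp_apply]
    rw [hXB, hX, h1, hT, hT, hVa]
  let S : H →L[ℂ] H := CFC.sqrt T
  have hSS : S * S = T := CFC.sqrt_mul_sqrt_self T hTpos
  have hSsymm : ∀ u v, inner ℂ (S u) v = inner ℂ u (S v) := by
    have : IsSelfAdjoint S := (CFC.sqrt_nonneg T).isSelfAdjoint
    exact (ContinuousLinearMap.isSelfAdjoint_iff_isSymmetric.1 this)
  have hSc : ∀ Y, Commute T Y → Commute S Y := fun Y hY => hY.cfcₙ_nnreal _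
  have hBX : ∀ v, 0 ≤ (inner ℂ (B v) (X v)).re := by
    refine fun v => hdense.induction_on (p := fun v => 0 ≤ (inner ℂ (B v) (X v)).re) v
      (isClosed_le (by fun_prop) (by fun_prop)) (fun x => ?_)
    simp only [LinearMap.comp_apply, hB, hX]
    exact hpos x
  have key := hBX (S (j (r x)))
  have hSB : B (S (j (r x))) = S (j x) := by
    rw [← hB x]; exact (DFunLike.congr_fun (hSc B hTB) _).symm
  have hSX : X (S (j (r x))) = S (j (a x)) := by
    rw [← hX x]; exact (DFunLike.congr_fun (hSc X hTX) _).symm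
  rwa [hSB, hSX, hSsymm, ← mul_apply_eq_comp, hSS, hT] at key

universe u

/-- Moving the form to a separate space keeps norms off `D`, so that several forms on one algebra
can coexist. -/
theorem exists_inner_realization {D : Type u} [AddCommGroup D] [Module ℂ D]
    (c : PreInnerProductSpace.Core ℂ D) :
    ∃ (E : Type u) (_ : SeminormedAddCommGroup E) (_ : InnerProductSpace ℂ E) (j : D ≃ₗ[ℂ] E),
      ∀ a b, inner ℂ (j a) (j b) = c.inner a b := by
  let := c
  let : SeminormedAddCommGroup D := InnerProductSpace.Core.toSeminormedAddCommGroup (𝕜 := ℂ)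
  let : InnerProductSpace ℂ D := InnerProductSpace.ofCore c
  exact ⟨D, inferInstance, inferInstance, LinearEquiv.refl ℂ D, fun _ _ => rfl⟩

/-! ### Positive functionals, Cauchy-Schwarz and coercivity -/

section Functional

variable {A : Type u} [Ring A] [StarRing A] [Algebra ℂ A]

/-- The squared seminorm `a ↦ ω(a* a)`. -/
def normSqOf (ω : Module.Dual ℂ A) (a : A) : ℝ := (ω (star a * a)).re

theorem normSqOf_smul_functional (ω : Module.Dual ℂ A) (c : ℝ) (a : A) :
    normSqOf ((c : ℂ) • ω) a = c * normSqOf ω a := by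
  simp [normSqOf]

variable [StarModule ℂ A]

/-- Hermitian functionals that are non-negative on the elements `a* a`. -/
def IsPosOnSquares (ω : Module.Dual ℂ A) : Prop :=
  IsHermFunctional ω ∧ ∀ a, 0 ≤ normSqOf ω a

theorem IsHermFunctional.apply_star {ω : Module.Dual ℂ A} (h : IsHermFunctional ω) (a : A) :
    ω (star a) = star (ω a) := by
  have := LinearMap.congr_fun h (star a)
  simpa [dualStar] using this.symm

/-- The form `(b, c) ↦ ω((y b)* (y c))`. -/
@[reducible] def formCore {ω : Module.Dual ℂ A} (hω : IsPosOnSquares ω) (y : A) :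
    PreInnerProductSpace.Core ℂ A where
  inner b c := ω (star (y * b) * (y * c))
  conj_inner_symm b c := by
    have := hω.1.apply_star (star (y * c) * (y * b))
    rw [star_mul, star_star] at this
    exact this.symm
  re_inner_nonneg b := hω.2 (y * b)
  add_left a b c := by simp [mul_add, add_mul]
  smul_left a b r := by simp

theorem exists_gns {ω : Module.Dual ℂ A} (hω : IsPosOnSquares ω) :
    ∃ (E : Type u) (_ : SeminormedAddCommGroup E) (_ : InnerProductSpace ℂ E) (j : A ≃ₗ[ℂ] E),
      (∀ a b, inner ℂ (j a) (j b) = ω (star a * b)) ∧ ∀ a, ‖j a‖ ^ 2 = normSqOf ω a := by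
  obtain ⟨E, i1, i2, j, hj⟩ := exists_inner_realization (formCore hω 1)
  have hj' : ∀ a b, inner ℂ (j a) (j b) = ω (star a * b) := fun a b => by
    rw [hj]; change ω (star (1 * a) * (1 * b)) = _; rw [one_mul, one_mul]
  exact ⟨E, i1, i2, j, hj', fun a => by rw [← inner_self_eq_norm_sq (𝕜 := ℂ), hj']; rfl⟩

theorem IsPosOnSquares.norm_sq_le {ω : Module.Dual ℂ A} (hω : IsPosOnSquares ω) (a b : A) :
    ‖ω (star a * b)‖ ^ 2 ≤ normSqOf ω a * normSqOf ω b := by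
  obtain ⟨E, _, _, j, hj, hn⟩ := exists_gns hω
  rw [← hj, ← hn, ← hn, ← mul_pow]
  exact pow_le_pow_left₀ (norm_nonneg _) (norm_inner_le_norm _ _) 2

theorem IsPosOnSquares.normSqOf_add_le {ω : Module.Dual ℂ A} (hω : IsPosOnSquares ω) (a b : A) :
    normSqOf ω (a + b) ≤ 2 * (normSqOf ω a + normSqOf ω b) := by
  have h := hω.2 (a - b)
  simp only [normSqOf, star_add, star_sub, add_mul, mul_add, sub_mul, mul_sub, map_add, map_sub,
    Complex.add_re, Complex.sub_re] at h ⊢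
  linarith

theorem normSqOf_smul (ω : Module.Dual ℂ A) (c : ℂ) (a : A) :
    normSqOf ω (c • a) = ‖c‖ ^ 2 * normSqOf ω a := by
  have : star c * c = ((‖c‖ ^ 2 : ℝ) : ℂ) := by
    have := Complex.conj_mul' c
    simpa using this
  simp only [normSqOf, star_smul, smul_mul_smul_comm, map_smul, this, smul_eq_mul,
    Complex.re_ofReal_mul]

theorem dualPos_isPosOnSquares {P : QuasiOrdered A} {ω : Module.Dual ℂ A} (hω : ω ∈ P.dualPos) :
    IsPosOnSquares ω :=
  ⟨hω.1, fun a => (Complex.le_def.1 (hω.2 _ (P.star_mul_self_pos a))).1⟩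

theorem dualPos_mono {P : QuasiOrdered A} {ω : Module.Dual ℂ A} (hω : ω ∈ P.dualPos)
    {a b : selfAdjoint A} (hab : P.le a b) (d : A) :
    (ω (star d * a * d)).re ≤ (ω (star d * b * d)).re := by
  have h1 := P.conj_le_conj a b d hab
  have h2 := P.add_le_add _ _ (-conjBy d a) h1
  rw [add_neg_cancel] at h2
  have h3 := (Complex.le_def.1 (hω.2 _ h2)).1
  have h4 : ((conjBy d b + -conjBy d a : selfAdjoint A) : A) = star d * b * d - star d * a * d := by
    simp [conjBy, sub_eq_add_neg]
  rw [h4, map_sub, Complex.sub_re] at h3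
  simpa using h3

theorem dualPos_coercive {P : QuasiOrdered A} {ω : Module.Dual ℂ A} (hω : ω ∈ P.dualPos)
    {q : selfAdjoint A} {ε : ℝ} (hq : P.le (ε • (1 : selfAdjoint A)) q) (d : A) :
    ε * normSqOf ω d ≤ (ω (star d * q * d)).re := by
  have h := dualPos_mono hω hq d
  have h1 : star d * ((ε • (1 : selfAdjoint A) : selfAdjoint A) : A) * d
      = (ε : ℂ) • (star d * d) := by
    rw [selfAdjoint.val_smul, selfAdjoint.val_one, mul_smul_comm, mul_one, smul_mul_assoc]
    rfl
  rw [h1, map_smul, smul_eq_mul, Complex.re_ofReal_mul] at h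
  exact h

/-- From `ε ‖d‖² ≤ ⟨d, q d⟩ ≤ ‖d‖ ‖q d‖`, after cancelling `‖d‖`. -/
theorem coercive_normSqOf_le {P : QuasiOrdered A} {ω : Module.Dual ℂ A} (hω : ω ∈ P.dualPos)
    {q : selfAdjoint A} {ε : ℝ} (hε : 0 < ε) (hq : P.le (ε • (1 : selfAdjoint A)) q) (d : A) :
    ε ^ 2 * normSqOf ω d ≤ normSqOf ω (q * d) := by
  have h1 := dualPos_coercive hω hq d
  have h2 := (dualPos_isPosOnSquares hω).norm_sq_le d (q * d)
  have h0 := (dualPos_isPosOnSquares hω).2 d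
  rw [mul_assoc] at h1
  have h3 := h1.trans (Complex.re_le_norm _)
  have h4 : (ε * normSqOf ω d) ^ 2 ≤ normSqOf ω d * normSqOf ω (q * d) :=
    (pow_le_pow_left₀ (by positivity) h3 2).trans h2
  rcases h0.lt_or_eq with h | h
  · refine le_of_mul_le_mul_left ?_ h
    linarith
  · rw [← h, mul_zero]
    exact (dualPos_isPosOnSquares hω).2 _

end Functional

/-! ### Dense range of the dominant elements -/

section Density

variable {A : Type u} [Ring A] [StarRing A] [Algebra ℂ A] [StarModule ℂ A]
  (O : AbstractOStarAlgebra A)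

variable {O} in
theorem posFunctionals_smul {ω : Module.Dual ℂ A} (hω : ω ∈ O.posFunctionals) {c : ℝ}
    (hc : 0 ≤ c) : (c : ℂ) • ω ∈ O.posFunctionals := by
  refine ⟨O.Ω.smul_mem _ hω.1, ?_, fun a ha => ?_⟩
  · ext a
    simp [dualStar, hω.2.1.apply_star]
  · have h := hω.2.2 a ha
    have hc' : (0 : ℂ) ≤ (c : ℂ) := by exact_mod_cast hc
    simpa using mul_nonneg hc' h

variable {O} in
theorem posFunctionals_add {ω ρ : Module.Dual ℂ A} (hω : ω ∈ O.posFunctionals)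
    (hρ : ρ ∈ O.posFunctionals) : ω + ρ ∈ O.posFunctionals := by
  refine ⟨O.Ω.add_mem hω.1 hρ.1, ?_, fun a ha => ?_⟩
  · ext a
    simp [dualStar, hω.2.1.apply_star, hρ.2.1.apply_star]
  · simpa using add_nonneg (hω.2.2 a ha) (hρ.2.2 a ha)

/-- Density of `y q A` in `y A` when the states are Stieltjes states for the coercive element `q`
and `y` commutes with `q`: the case of a unit vector. -/
theorem exists_normSqOf_mul_sub_lt_of_state {σ : Module.Dual ℂ A} (hσ : σ ∈ O.states)
    {q : selfAdjoint A} (hq : O.IsCoercive q) (hst : IsStieltjesState σ q)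
    {y : A} (hy : Commute y q) {b : A} (hb : σ (star (y * b) * (y * b)) = 1) {δ : ℝ}
    (hδ : 0 < δ) : ∃ w : A, normSqOf σ (y * b - y * (q * w)) < δ := by
  obtain ⟨-, ε, hε, hqε⟩ := hq
  have hσ2 := dualPos_isPosOnSquares hσ.1.2
  -- In the form twisted by `y` the claim says that `b` is a limit of elements `q w`; since `y`
  -- commutes with `q`, left multiplication by `q` is symmetric for this form.
  obtain ⟨E, _, _, j, hj⟩ := exists_inner_realization (formCore hσ2 y)
  replace hj : ∀ a b, inner ℂ (j a) (j b) = σ (star (y * a) * (y * b)) := hj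
  have hn : ∀ a, ‖j a‖ ^ 2 = normSqOf σ (y * a) := fun a => by
    rw [← inner_self_eq_norm_sq (𝕜 := ℂ), hj]; rfl
  by_contra hcon
  push Not at hcon
  let T : E →ₗ[ℂ] E := j.toLinearMap ∘ₗ LinearMap.mulLeft ℂ (q : A) ∘ₗ j.symm.toLinearMap
  have hT : ∀ a, T (j a) = j (q * a) := fun a => by simp [T]
  have hTpow : ∀ n a, (T ^ n) (j a) = j ((q : A) ^ n * a) := by
    intro n
    induction n with
    | zero => simp
    | succ n ih => intro a; rw [pow_succ, Module.End.mul_apply, hT, ih, pow_succ, mul_assoc]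
  have hqs : star (q : A) = q := q.2
  have hform : ∀ n a, inner ℂ (j a) (j ((q : A) ^ n * a)) = act (y * a) σ ((q : A) ^ n) := by
    intro n a
    rw [hj, act_apply, ← mul_assoc y, (hy.pow_right n).eq, mul_assoc]
  refine carleman_series_ne_top_of_le_norm_sub (q := T) (ψ := j b) (δ := √δ) (ε := ε) ?_
    (Real.sqrt_pos.2 hδ) hε ?_ ?_ ?_ ?_
  · have h1 : ‖j b‖ ^ 2 = 1 := by rw [hn, normSqOf, hb, Complex.one_re]
    exact (pow_eq_one_iff_of_nonneg (norm_nonneg _) two_ne_zero).1 h1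
  · intro w
    obtain ⟨w, rfl⟩ := j.surjective w
    refine Real.sqrt_le_iff.2 ⟨norm_nonneg _, ?_⟩
    rw [hT, ← map_sub, hn, mul_sub]
    exact hcon w
  · intro x z
    obtain ⟨x, rfl⟩ := j.surjective x
    obtain ⟨z, rfl⟩ := j.surjective z
    rw [hT, hT, hj, hj, ← mul_assoc y, ← mul_assoc y, hy.eq, mul_assoc (q : A), star_mul, hqs,
      mul_assoc (q : A), mul_assoc]
  · intro x
    obtain ⟨x, rfl⟩ := j.surjective x
    rw [hT, hn]
    have h := hform 1 x
    rw [pow_one] at h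
    rw [h, act_apply, ← mul_assoc]
    exact dualPos_coercive hσ.1.2 hqε _
  -- The vanishing alternative contradicts coercivity: the value is at least `ε`.
  · have h1 := (hst (y * b) hb).resolve_left ?_
    · rw [← h1]
      congr 1
      ext n
      rw [hTpow, hform]
    · intro h0
      have h2 := dualPos_coercive hσ.1.2 hqε (y * b)
      rw [normSqOf, hb, mul_assoc, ← act_apply, h0] at h2
      simp at h2
      linarith

theorem exists_normSqOf_mul_sub_lt {ρ : Module.Dual ℂ A} (hρ : ρ ∈ O.posFunctionals)
    {q : selfAdjoint A} (hq : O.IsCoercive q) (hst : ∀ σ ∈ O.states, IsStieltjesState σ q)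
    {y : A} (hy : Commute y q) (b : A) {δ : ℝ} (hδ : 0 < δ) :
    ∃ w : A, normSqOf ρ (y * b - y * (q * w)) < δ := by
  have hρ2 := dualPos_isPosOnSquares hρ.2
  rcases (hρ2.2 (y * b)).lt_or_eq with hN | hN
  swap
  · exact ⟨0, by simpa [← hN] using hδ⟩
  set N := normSqOf ρ (y * b) with hNdef
  have hreal : ∀ a, ρ (star a * a) = (normSqOf ρ a : ℂ) := by
    intro a
    refine (Complex.conj_eq_iff_re.1 ?_).symm
    have := hρ.2.1.apply_star (star a * a)
    rw [star_mul, star_star] at this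
    exact this.symm
  set R := normSqOf ρ 1 with hR
  have hRpos : 0 < R := by
    -- By Cauchy-Schwarz, `ρ 1 = 0` would make `ρ` vanish identically.
    refine (hρ2.2 1).lt_of_ne' fun h => ?_
    have h1 := hρ2.norm_sq_le 1 (star (y * b) * (y * b))
    rw [h, zero_mul, star_one, one_mul, hreal, Complex.norm_real] at h1
    have : 0 < ‖normSqOf ρ (y * b)‖ ^ 2 := pow_pos (norm_pos_iff.2 hN.ne') 2
    linarith
  have hρ1 : ρ 1 = (R : ℂ) := by simpa using hreal 1
  have hσ : ((R⁻¹ : ℝ) : ℂ) • ρ ∈ O.states := by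
    refine ⟨posFunctionals_smul hρ (inv_nonneg.2 hRpos.le), ?_⟩
    rw [LinearMap.smul_apply, hρ1, smul_eq_mul, ← Complex.ofReal_mul, inv_mul_cancel₀ hRpos.ne',
      Complex.ofReal_one]
  -- This factor makes `y * (s • b)` a unit vector for the state `R⁻¹ • ρ`.
  set s : ℝ := √(R / N) with hs
  have hs0 : 0 < s := Real.sqrt_pos.2 (div_pos hRpos hN)
  have hs2 : s ^ 2 = R / N := Real.sq_sqrt (div_pos hRpos hN).le
  have hb : (((R⁻¹ : ℝ) : ℂ) • ρ) (star (y * ((s : ℂ) • b)) * (y * ((s : ℂ) • b))) = 1 := by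
    rw [LinearMap.smul_apply, hreal, mul_smul_comm, normSqOf_smul, Complex.norm_real,
      Real.norm_of_nonneg hs0.le, hs2, ← hNdef, smul_eq_mul, ← Complex.ofReal_mul,
      div_mul_cancel₀ _ hN.ne', inv_mul_cancel₀ hRpos.ne', Complex.ofReal_one]
  obtain ⟨w, hw⟩ := exists_normSqOf_mul_sub_lt_of_state O hσ hq (hst _ hσ) hy hb (div_pos hδ hN)
  refine ⟨((s⁻¹ : ℝ) : ℂ) • w, ?_⟩
  have hsc : (s : ℂ) ≠ 0 := by exact_mod_cast hs0.ne'
  have h1 : y * ((s : ℂ) • b) - y * (q * w) =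
      (s : ℂ) • (y * b - y * (q * (((s⁻¹ : ℝ) : ℂ) • w))) := by
    rw [smul_sub, mul_smul_comm, mul_smul_comm, mul_smul_comm, Complex.ofReal_inv,
      smul_inv_smul₀ hsc]
  rw [h1, normSqOf_smul_functional, normSqOf_smul, Complex.norm_real, Real.norm_of_nonneg hs0.le,
    hs2, lt_div_iff₀ hN] at hw
  have h2 : R⁻¹ * (R / N * normSqOf ρ (y * b - y * (q * (((s⁻¹ : ℝ) : ℂ) • w)))) * N
      = normSqOf ρ (y * b - y * (q * (((s⁻¹ : ℝ) : ℂ) • w))) := by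
    field_simp
  rwa [h2] at hw

variable {O} {Q' : Set (selfAdjoint A)}

theorem exists_normSqOf_sub_prod_mul_lt (hco : ∀ q ∈ Q', O.IsCoercive q)
    (hcomm : ∀ p ∈ Q', ∀ q ∈ Q', Commute (p : A) (q : A))
    (hst : ∀ ω ∈ O.states, ∀ q ∈ Q', IsStieltjesState ω q)
    {ρ : Module.Dual ℂ A} (hρ : ρ ∈ O.posFunctionals) (l : List (selfAdjoint A))
    (hl : ∀ x ∈ l, x ∈ Q') (b : A) {δ : ℝ} (hδ : 0 < δ) :
    ∃ w : A, normSqOf ρ (b - (l.map (fun x : selfAdjoint A => (x : A))).prod * w) < δ := by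
  induction l generalizing δ with
  | nil => exact ⟨b, by simpa [normSqOf] using hδ⟩
  | cons x l ih =>
    -- Approximate `b` by `p v`, then `p v` by `p x w`. The quarters of `δ` absorb the factor 2 in
    -- the squared triangle inequality.
    obtain ⟨v, hv⟩ := ih (fun z hz => hl z (List.mem_cons_of_mem _ hz)) (δ := δ / 4) (by positivity)
    have hx : x ∈ Q' := hl x List.mem_cons_self
    set p := (l.map (fun x : selfAdjoint A => (x : A))).prod with hp
    have hpx : Commute p (x : A) := by
      refine Commute.list_prod_left _ _ fun z hz => ?_
      obtain ⟨z', hz', rfl⟩ := List.mem_map.1 hz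
      exact hcomm _ (hl z' (List.mem_cons_of_mem _ hz')) _ hx
    obtain ⟨w, hw⟩ := exists_normSqOf_mul_sub_lt O hρ (hco x hx) (fun σ hσ => hst σ hσ x hx) hpx v
      (δ := δ / 4) (by positivity)
    refine ⟨w, ?_⟩
    have h1 : b - (List.map (fun x : selfAdjoint A => (x : A)) (x :: l)).prod * w
        = (b - p * v) + (p * v - p * (x * w)) := by
      rw [List.map_cons, List.prod_cons, ← hp, ← hpx.eq, mul_assoc]; abel
    rw [h1]
    have := (dualPos_isPosOnSquares hρ.2).normSqOf_add_le (b - p * v) (p * v - p * (x * w))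
    linarith

theorem exists_normSqOf_le_prod_mul (hco : ∀ q ∈ Q', O.IsCoercive q)
    (l : List (selfAdjoint A)) (hl : ∀ x ∈ l, x ∈ Q') :
    ∃ C : ℝ, 0 < C ∧ ∀ ρ ∈ O.posFunctionals, ∀ d : A,
      normSqOf ρ d ≤ C * normSqOf ρ ((l.map (fun x : selfAdjoint A => (x : A))).prod * d) := by
  induction l with
  | nil => exact ⟨1, one_pos, by simp⟩
  | cons x l ih =>
    obtain ⟨C, hC, h⟩ := ih fun z hz => hl z (List.mem_cons_of_mem _ hz)
    obtain ⟨-, ε, hε, hx⟩ := hco x (hl x List.mem_cons_self)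
    refine ⟨C / ε ^ 2, by positivity, fun ρ hρ d => (h ρ hρ d).trans ?_⟩
    have h1 := coercive_normSqOf_le hρ.2 hε hx
      ((l.map (fun x : selfAdjoint A => (x : A))).prod * d)
    rw [List.map_cons, List.prod_cons, mul_assoc (x : A), div_mul_eq_mul_div, mul_div_assoc]
    refine mul_le_mul_of_nonneg_left ?_ hC.le
    rw [le_div_iff₀ (by positivity), mul_comm]
    exact h1

theorem exists_normSqOf_sub_dominant_mul_lt (hco : ∀ q ∈ Q', O.IsCoercive q)
    (hcomm : ∀ p ∈ Q', ∀ q ∈ Q', Commute (p : A) (q : A))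
    (hst : ∀ ω ∈ O.states, ∀ q ∈ Q', IsStieltjesState ω q)
    {ρ : Module.Dual ℂ A} (hρ : ρ ∈ O.posFunctionals) {r : selfAdjoint A}
    (hr : r ∈ dominantSet Q') (b : A) {δ : ℝ} (hδ : 0 < δ) :
    ∃ w : A, normSqOf ρ (b - r * w) < δ := by
  obtain ⟨c, l, hc, -, hl, hrl⟩ := hr
  obtain ⟨w, hw⟩ := exists_normSqOf_sub_prod_mul_lt hco hcomm hst hρ l hl b hδ
  refine ⟨c⁻¹ • w, ?_⟩
  rwa [hrl, smul_mul_assoc, mul_smul_comm, smul_inv_smul₀ (by positivity)]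

theorem exists_normSqOf_le_dominant_mul (hco : ∀ q ∈ Q', O.IsCoercive q) {r : selfAdjoint A}
    (hr : r ∈ dominantSet Q') :
    ∃ C : ℝ, 0 < C ∧ ∀ ρ ∈ O.posFunctionals, ∀ d : A,
      normSqOf ρ d ≤ C * normSqOf ρ (r * d) := by
  obtain ⟨c, l, hc, -, hl, hrl⟩ := hr
  obtain ⟨C, hC, h⟩ := exists_normSqOf_le_prod_mul hco l hl
  refine ⟨C, hC, fun ρ hρ d => (h ρ hρ d).trans (mul_le_mul_of_nonneg_left ?_ hC.le)⟩
  have h0 := (dualPos_isPosOnSquares hρ.2).2 ((l.map (fun x : selfAdjoint A => (x : A))).prod * d)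
  rw [hrl, smul_mul_assoc, ← Complex.coe_smul, normSqOf_smul, Complex.norm_real,
    Real.norm_of_nonneg (by linarith)]
  exact le_mul_of_one_le_left h0 (one_le_pow₀ hc)

end Density

/-! ### Domination, positivity on `Q↓` and strong approximation -/

variable {A : Type u} [Ring A] [StarRing A] [Algebra ℂ A] [StarModule ℂ A]
  {O : AbstractOStarAlgebra A}

/-- Cauchy-Schwarz holds for each positive generator and survives linear combinations. The case `a =
b` gives domination on squares, the case `a = 1` strong continuity. -/
theorem exists_norm_sq_le_of_mem {ω : Module.Dual ℂ A} (hω : ω ∈ O.Ω) :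
    ∃ ρ ∈ O.posFunctionals, ∀ a b, ‖ω (star a * b)‖ ≤ √(normSqOf ρ a) * √(normSqOf ρ b) := by
  rw [← O.span_pos] at hω
  have h0 : (0 : Module.Dual ℂ A) ∈ O.posFunctionals :=
    ⟨O.Ω.zero_mem, by ext; simp [dualStar], fun _ _ => le_rfl⟩
  induction hω using Submodule.span_induction with
  | mem ρ hρ =>
    refine ⟨ρ, hρ, fun a b => ?_⟩
    rw [← Real.sqrt_mul ((dualPos_isPosOnSquares hρ.2).2 a)]
    exact Real.le_sqrt_of_sq_le ((dualPos_isPosOnSquares hρ.2).norm_sq_le a b)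
  | zero => exact ⟨0, h0, fun a b => by simp [normSqOf]⟩
  | add ω₁ ω₂ _ _ ih₁ ih₂ =>
    obtain ⟨ρ₁, hρ₁, h₁⟩ := ih₁
    obtain ⟨ρ₂, hρ₂, h₂⟩ := ih₂
    refine ⟨ρ₁ + ρ₂, posFunctionals_add hρ₁ hρ₂, fun a b => ?_⟩
    have hadd : ∀ x, normSqOf (ρ₁ + ρ₂) x = normSqOf ρ₁ x + normSqOf ρ₂ x := fun x => by
      simp [normSqOf]
    have n₁ := (dualPos_isPosOnSquares hρ₁.2).2
    have n₂ := (dualPos_isPosOnSquares hρ₂.2).2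
    rw [hadd, hadd, ← Real.sqrt_mul (add_nonneg (n₁ a) (n₂ a)), LinearMap.add_apply]
    refine (norm_add_le _ _).trans ((add_le_add (h₁ a b) (h₂ a b)).trans (Real.le_sqrt_of_sq_le ?_))
    have s₁ := Real.sq_sqrt (n₁ a)
    have s₂ := Real.sq_sqrt (n₁ b)
    have s₃ := Real.sq_sqrt (n₂ a)
    have s₄ := Real.sq_sqrt (n₂ b)
    rw [← s₁, ← s₂, ← s₃, ← s₄]
    simp only [Real.sqrt_sq (Real.sqrt_nonneg _)]
    nlinarith [sq_nonneg (√(normSqOf ρ₁ a) * √(normSqOf ρ₂ b) -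
      √(normSqOf ρ₁ b) * √(normSqOf ρ₂ a))]
  | smul c ω _ ih =>
    obtain ⟨ρ, hρ, h⟩ := ih
    refine ⟨((‖c‖ : ℝ) : ℂ) • ρ, posFunctionals_smul hρ (norm_nonneg c), fun a b => ?_⟩
    rw [normSqOf_smul_functional, normSqOf_smul_functional, Real.sqrt_mul (norm_nonneg c),
      Real.sqrt_mul (norm_nonneg c), mul_mul_mul_comm, Real.mul_self_sqrt (norm_nonneg c),
      LinearMap.smul_apply, norm_smul]
    exact mul_le_mul_of_nonneg_left (h a b) (norm_nonneg c)

/-- Positivity on the positive elements of `Q↓` of a functional that is dominated by `ρ` on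
squares. -/
theorem re_apply_nonneg_of_mem_down {Q' : Set (selfAdjoint A)} (hne : Q'.Nonempty)
    (hco : ∀ q ∈ Q', O.IsCoercive q)
    (hcomm : ∀ p ∈ Q', ∀ q ∈ Q', Commute (p : A) (q : A))
    (hst : ∀ ω ∈ O.states, ∀ q ∈ Q', IsStieltjesState ω q)
    {ω ρ : Module.Dual ℂ A} (hω : IsPosOnSquares ω) (hρ : ρ ∈ O.posFunctionals)
    (hωρ : ∀ a, normSqOf ω a ≤ normSqOf ρ a) {a : selfAdjoint A} (ha : a ∈ O.posElements)
    (had : (a : A) ∈ O.down (dominantSet Q')) : 0 ≤ (ω (a : A)).re := by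
  obtain ⟨q₀, hq₀⟩ := hne
  have hqQ : q₀ ∈ dominantSet Q' :=
    ⟨1, [q₀], le_rfl, by simp, by simpa using hq₀, by simp⟩
  obtain ⟨r, hr, -, -, hle, -⟩ := had q₀ hqQ
  obtain ⟨C₁, hC₁, h₁⟩ := exists_normSqOf_le_dominant_mul hco hr
  obtain ⟨C₂, hC₂, h₂⟩ := exists_normSqOf_le_dominant_mul hco hqQ
  have has : star (a : A) = a := a.2
  have hrs : star (r : A) = r := r.2
  have hqs : star (q₀ : A) = q₀ := q₀.2
  -- Coercivity of `q₀` bounds `‖a d‖` by a multiple of `‖q₀ a d‖`, and `a q₀² a ≲ r²` bounds that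
  -- by `‖r d‖`.
  have h₃ : ∀ d, normSqOf ρ (a * d) ≤ C₂ * normSqOf ρ (r * d) := by
    intro d
    refine (h₂ ρ hρ (a * d)).trans (mul_le_mul_of_nonneg_left ?_ hC₂.le)
    have h := dualPos_mono hρ.2 hle d
    have e1 : star d * ((conjBy (a : A) (q₀ ^ 2) : selfAdjoint A) : A) * d
        = star (q₀ * (a * d)) * (q₀ * (a * d)) := by
      simp only [conjBy, selfAdjoint.val_pow, star_mul, has, hqs, pow_two, mul_assoc]
    have e2 : star d * ((r ^ 2 : selfAdjoint A) : A) * d = star (r * d) * (r * d) := by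
      simp only [selfAdjoint.val_pow, star_mul, hrs, pow_two, mul_assoc]
    rw [e1, e2] at h
    exact h
  have hρ2 := dualPos_isPosOnSquares hρ.2
  obtain ⟨E, _, _, j, hj, hjn⟩ := exists_gns hρ2
  obtain ⟨F, _, _, k, hk, hkn⟩ := exists_gns hω
  let J : A →ₗ[ℂ] UniformSpace.Completion E :=
    (UniformSpace.Completion.toComplL (𝕜 := ℂ) (E := E)).toLinearMap ∘ₗ j.toLinearMap
  let K : A →ₗ[ℂ] UniformSpace.Completion F :=
    (UniformSpace.Completion.toComplL (𝕜 := ℂ) (E := F)).toLinearMap ∘ₗ k.toLinearMap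
  have hJ : ∀ a b, inner ℂ (J a) (J b) = ρ (star a * b) := fun a b =>
    (UniformSpace.Completion.inner_coe _ _).trans (hj a b)
  have hK : ∀ a b, inner ℂ (K a) (K b) = ω (star a * b) := fun a b =>
    (UniformSpace.Completion.inner_coe _ _).trans (hk a b)
  have hJn : ∀ a, ‖J a‖ = √(normSqOf ρ a) := fun a => by
    rw [← hjn, Real.sqrt_sq (norm_nonneg _)]; exact UniformSpace.Completion.norm_coe _
  have hKn : ∀ a, ‖K a‖ = √(normSqOf ω a) := fun a => by
    rw [← hkn, Real.sqrt_sq (norm_nonneg _)]; exact UniformSpace.Completion.norm_coe _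
  have hJd : DenseRange J := by
    have := UniformSpace.Completion.denseRange_coe (α := E)
    refine this.mono ?_
    rintro _ ⟨x, rfl⟩
    exact ⟨j.symm x, by simp [J]⟩
  let V : UniformSpace.Completion E →L[ℂ] UniformSpace.Completion F := K.extendOfNorm J
  have hV : ∀ a, V (J a) = K a := LinearMap.extendOfNorm_eq hJd
    ⟨1, fun a => by rw [one_mul, hJn, hKn]; exact Real.sqrt_le_sqrt (hωρ a)⟩
  have hdense : DenseRange (J ∘ₗ LinearMap.mulLeft ℂ (r : A)) := by
    have hsub : Set.range J ⊆ closure (Set.range (J ∘ₗ LinearMap.mulLeft ℂ (r : A))) := by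
      rintro _ ⟨b, rfl⟩
      refine Metric.mem_closure_iff.2 fun δ hδ => ?_
      obtain ⟨w, hw⟩ := exists_normSqOf_sub_dominant_mul_lt hco hcomm hst hρ hr b
        (δ := δ ^ 2) (by positivity)
      refine ⟨_, ⟨w, rfl⟩, ?_⟩
      rw [dist_eq_norm]
      change ‖J b - J (r * w)‖ < δ
      rw [← map_sub, hJn]
      exact (Real.sqrt_lt' hδ).2 hw
    exact dense_closure.1 (hJd.mono hsub)
  have hC : ∀ {x y C : ℝ}, 0 ≤ C → C ≤ C₁ + C₂ → 0 ≤ y → x ≤ C * y →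
      √x ≤ √(C₁ + C₂) * √y := by
    intro x y C hC0 hC hy hxy
    rw [← Real.sqrt_mul (by positivity)]
    exact Real.sqrt_le_sqrt (hxy.trans (mul_le_mul_of_nonneg_right hC hy))
  have hsymm : ∀ (φ : Module.Dual ℂ A) {c : A}, star c = c → ∀ x y,
      φ (star (c * x) * y) = φ (star x * (c * y)) := by
    intro φ c hc x y
    rw [star_mul, hc, mul_assoc]
  have key := re_inner_map_nonneg_of_weakly_commuting J (LinearMap.mulLeft ℂ (a : A))
    (LinearMap.mulLeft ℂ (r : A)) V (√(C₁ + C₂))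
    (fun x y => by simpa only [LinearMap.mulLeft_apply, hJ] using hsymm ρ hrs x y)
    (fun x y => by simpa only [LinearMap.mulLeft_apply, hJ] using hsymm ρ has x y)
    hdense
    (fun x => by
      rw [hJn, hJn]
      exact hC hC₁.le (by linarith) (hρ2.2 _) (h₁ ρ hρ x))
    (fun x => by
      rw [hJn, hJn]
      exact hC hC₂.le (by linarith) (hρ2.2 _) (h₃ x))
    (fun x => by
      have h := dualPos_mono hρ.2 ha x
      rw [hJ, LinearMap.mulLeft_apply, ← mul_assoc]
      simpa using h)
    (fun x y => by simpa only [LinearMap.mulLeft_apply, hV, hK] using hsymm ω hrs x y)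
    (fun x y => by simpa only [LinearMap.mulLeft_apply, hV, hK] using hsymm ω has x y) 1
  simpa [hV, hK] using key

theorem exists_normSqOf_sub_lt_of_mem_closure {s : Set A} {a : A}
    (ha : a ∈ closure[O.strongTopology] s) {ρ : Module.Dual ℂ A} (hρ : ρ ∈ O.posFunctionals)
    {δ : ℝ} (hδ : 0 < δ) : ∃ d ∈ s, normSqOf ρ (d - a) < δ := by
  let : TopologicalSpace A := O.strongTopology
  have hp : WithSeminorms O.strongSeminormFamily := ⟨rfl⟩
  have hnhds : (O.strongSeminorm hρ.2).ball a (√δ) ∈ 𝓝 a :=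
    (hp.mem_nhds_iff _ _).2 ⟨{⟨ρ, hρ⟩}, √δ, Real.sqrt_pos.2 hδ, by
      rw [Finset.sup_singleton]; exact subset_rfl⟩
  obtain ⟨d, hd, hds⟩ := mem_closure_iff_nhds.1 ha _ hnhds
  refine ⟨d, hds, ?_⟩
  rw [Seminorm.mem_ball, QuasiOrdered.strongSeminorm_apply] at hd
  exact (Real.sqrt_lt_sqrt_iff_of_pos hδ).1 hd

end OStar

theorem mainTheorem8 {A : Type*} [Ring A] [StarRing A] [Algebra ℂ A] [StarModule ℂ A]
    (O : OStar.AbstractOStarAlgebra A)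
    (hdown : O.IsDownwardsClosed)
    (hstieltjes : O.HasSufficientlyManyStieltjesStates) :
    O.IsRegular := by
  obtain ⟨Q', hne, hco, hcomm, hst, hclosure⟩ := hstieltjes
  intro ω hω hpos
  obtain ⟨ρ, hρ, hωρ⟩ := OStar.exists_norm_sq_le_of_mem hω.1
  have hρ2 := OStar.dualPos_isPosOnSquares hρ.2
  have hω2 : OStar.IsPosOnSquares ω := by
    refine ⟨hω.2, fun a => (Complex.le_def.1 (hpos _ ⟨1, fun _ => a, ?_⟩)).1⟩
    simp
  have hdom : ∀ a, OStar.normSqOf ω a ≤ OStar.normSqOf ρ a := fun a => by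
    have h := (Complex.re_le_norm _).trans (hωρ a a)
    rwa [Real.mul_self_sqrt (hρ2.2 a)] at h
  refine ⟨hω.1, hω.2, fun a ha => ?_⟩
  have him : star (ω (a : A)) = ω (a : A) := by
    rw [← OStar.IsHermFunctional.apply_star hω.2, a.2.star_eq]
  refine Complex.le_def.2 ⟨?_, (Complex.conj_eq_iff_im.1 him).symm⟩
  refine le_of_forall_pos_le_add fun δ hδ => ?_
  set R := √(OStar.normSqOf ρ 1) with hR
  have hR0 : 0 ≤ R := Real.sqrt_nonneg _
  -- The denominator is `R + 1` because `R` may vanish.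
  obtain ⟨_, ⟨d, rfl, hd, hdd⟩, hlt⟩ := OStar.exists_normSqOf_sub_lt_of_mem_closure
    (hclosure a ha) hρ (δ := (δ / (R + 1)) ^ 2) (by positivity)
  have h1 := OStar.re_apply_nonneg_of_mem_down hne hco hcomm hst hω2 hρ hdom hd hdd
  have h2 := hωρ 1 ((d : A) - a)
  rw [star_one, one_mul, map_sub, ← hR] at h2
  have h3 : √(OStar.normSqOf ρ ((d : A) - a)) < δ / (R + 1) :=
    (Real.sqrt_lt' (by positivity)).2 hlt
  have h4 : R * √(OStar.normSqOf ρ ((d : A) - a)) ≤ δ := by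
    calc _ ≤ (R + 1) * (δ / (R + 1)) :=
          mul_le_mul (by linarith) h3.le (Real.sqrt_nonneg _) (by linarith)
      _ = δ := by field_simp
  have h5 := (Complex.re_le_norm _).trans (h2.trans h4)
  rw [Complex.sub_re] at h5
  simp only [LinearMap.zero_apply, Complex.zero_re]
  linarith
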